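/- Let $F$ be a field and let $\Gamma$ be a row-finite directed graph with vertex set $\Gamma^0$, edge set $\Gamma^1$ and source and range maps $s, r : \Gamma^1 \to \Gamma^0$; row-finite means that $s^{-1}(v)$ is finite for every vertex $v$, and the out-degree of $v$ is $|s^{-1}(v)|$. For each edge $e$ let $e^*$ be a ghost edge, with $s(e^*) = r(e)$ and $r(e^*) = s(e)$, and put $s(v) = r(v) = v$ for $v \in \Gamma^0$. Consider the relations (1) $s(x)x = x\,r(x) = x$ for $x \in \Gamma^0 \cup \Gamma^1 \cup (\Gamma^1)^*$; (2) $uv = 0$ for $u, v \in \Gamma^0$ with $u \ne v$; (3) $e^*f = 0$ for $e, f \in \Gamma^1$ with $e \ne f$; (4) $e^*e = r(e)$ for $e \in \Gamma^1$; (5) $v = \sum_{e \in s^{-1}(v)} ee^*$ for each $v \in \Gamma^0$ that is not a sink (i.e. $s^{-1}(v) \neq \emptyset$); (v) $e_ve_v^* = v$ for each $v \in \Gamma^0$ of out-degree $1$, where $e_v$ is the unique edge with source $v$. Let $L_F(\Gamma)$ (the Leavitt path algebra) be the associative, not necessarily unital, $F$-algebra generated by $\Gamma^0 \cup \Gamma^1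 \cup (\Gamma^1)^*$ subject to (1)–(5). Let $LI(\Gamma)$ be the multiplicative subsemigroup with zero of $L_F(\Gamma)$ generated by $\Gamma^0 \cup \Gamma^1 \cup (\Gamma^1)^*$, i.e. the smallest subset that contains these generators and $0$ and is closed under multiplication. Let $L(\Gamma)$ be the semigroup with zero presented by the generators $\Gamma^0 \cup \Gamma^1 \cup (\Gamma^1)^*$ and the relations (1)–(4) and (v). Then there is an isomorphism $L(\Gamma) \to LI(\Gamma)$ that maps $0$ to $0$ and each generator to the generator of the same name, and both semigroups are inverse semigroups: every element $a$ has a unique $b$ with $aba = a$ and $bab = b$. Moreover, the non-zero elements of $LI(\Gamma)$, and likewise those of $L(\Gamma)$, are precisely the elements $pq^*$ in one of the following forms, and for each of them the pair $(p, q)$ of paths is unique: (a) $p$ and $q$ are (possibly empty) directed paths with $r(p) = r(q)$ that do not have the same last edge (in particular, every such pair with $p$ or $q$ empty is of this form); (b) $p = p'e$ and $q = q'e$, so that $pq^* = p'ee^*q'^*$, where $e$ is an edge, $p'$ and $q'$ are (possibly empty) directed paths with $r(p') = r(q') = s(e)$, and the vertex $s(e)$ has out-degree at least $2$. Here the empty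 path at a vertex $v$ stands for the element $v$, and $(e_1 \cdots e_n)^* = e_n^* \cdots e_1^*$. -/

import Mathlib

/-!
Directed graphs are quivers: the vertex set is `V`, and the set of edges is `Quiver.Total V`, where
an edge `e` has source `e.left` and range `e.right`. Directed paths are `Quiver.Path`s; the empty
path at each vertex is included.
-/

namespace LeavittGraph

open Quiver

universe u w

/-- The edges with source `v`, that is, `s⁻¹(v)`. The out-degree of `v` is `(outEdges v).encard`. -/
def outEdges {V : Type u} [Quiver.{w} V] (v : V) : Set (Total V) := {e | e.left = v}

/-- The generating set: vertices, edges `e` and ghost edges `e*`. -/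
inductive Gen (V : Type u) [Quiver.{w} V] : Type max u w
  | vertex (v : V) : Gen V
  | edge (e : Total V) : Gen V
  | ghost (e : Total V) : Gen V

namespace Gen

variable {V : Type u} [Quiver.{w} V]

/-- The source of a generator: `s(v) = v`, and `s(e*) = r(e)`. -/
def source : Gen V → V
  | vertex v => v
  | edge e => e.left
  | ghost e => e.right

/-- The range of a generator: `r(v) = v`, and `r(e*) = s(e)`. -/
def range : Gen V → V
  | vertex v => v
  | edge e => e.right
  | ghost e => e.left

end Gen

section Semigroups

variable (V : Type u) [Quiver.{w} V]

/-- The free semigroup with zero on the vertices, edges and ghost edges. -/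
abbrev FreeZero : Type max u w := WithZero (FreeSemigroup (Gen V))

variable {V}

/-- A generator as a word of length one. -/
def word (g : Gen V) : FreeZero V := ((FreeSemigroup.of g : FreeSemigroup (Gen V)) : FreeZero V)

/-- The defining relations (1)-(4) of the graph inverse semigroup of a graph. -/
inductive GraphRel : FreeZero V → FreeZero V → Prop
  | source_mul (g : Gen V) : GraphRel (word (.vertex g.source) * word g) (word g)
  | mul_range (g : Gen V) : GraphRel (word g * word (.vertex g.range)) (word g)
  | vertex_mul_vertex (v v' : V) (h : v ≠ v') :
      GraphRel (word (.vertex v) * word (.vertex v')) 0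
  | ghost_mul_edge (e f : Total V) (h : e ≠ f) : GraphRel (word (.ghost e) * word (.edge f)) 0
  | ghost_mul_self (e : Total V) :
      GraphRel (word (.ghost e) * word (.edge e)) (word (.vertex e.right))

/-- The defining relations of the semigroup `L(Γ)`: those of the graph inverse semigroup, and
`e e* = v` whenever `e` is the only edge with source `v`. -/
inductive LRel : FreeZero V → FreeZero V → Prop
  | graph {x y : FreeZero V} (h : GraphRel x y) : LRel x y
  | outDegree_one (v : V) (e : Total V) (hv : (outEdges v).encard = 1) (he : e ∈ outEdges v) :
      LRel (word (.edge e) * word (.ghost e)) (word (.vertex v))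

variable (V)

/-- The semigroup with zero `L(Γ)` presented by the vertices, edges and ghost edges and the
relations `LRel`. -/
def LSemigroup : Type max u w := (conGen (LRel (V := V))).Quotient

namespace LSemigroup

/-- The canonical map from words to `L(Γ)`. -/
def mk (x : FreeZero V) : LSemigroup V := Con.toQuotient (c := conGen (LRel (V := V))) x

instance : Semigroup (LSemigroup V) := inferInstanceAs (Semigroup (conGen (LRel (V := V))).Quotient)

instance : SemigroupWithZero (LSemigroup V) where
  zero := mk V 0
  zero_mul a := Quotient.inductionOn' a fun x => congrArg (mk V) (zero_mul x)
  mul_zero a := Quotient.inductionOn' a fun x => congrArg (mk V) (mul_zero x)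

variable {V}

/-- The generators of `L(Γ)`. -/
def of (g : Gen V) : LSemigroup V := mk V (word g)

end LSemigroup

end Semigroups

section Algebra

variable (F : Type*) [Field F] (V : Type u) [Quiver.{w} V]

/-- The free (non-unital, associative) `F`-algebra on the vertices, edges and ghost edges. -/
abbrev FreeAlg : Type _ := MonoidAlgebra F (FreeSemigroup (Gen V))

variable {V}

/-- A word of the free semigroup with zero, as an element of the free algebra. -/
noncomputable def wordAlg : FreeZero V → FreeAlg F V :=
  WithZero.recZeroCoe 0 fun x => MonoidAlgebra.single x 1

/-- The defining relations of the Leavitt path algebra: (1)-(4), and the Cuntz-Krieger relations (5)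
`v = ∑ e e*`, the sum over the edges `e` with source `v`, for each vertex `v` that is not a sink and
has finite out-degree. -/
inductive LeavittRel : FreeAlg F V → FreeAlg F V → Prop
  | graph {x y : FreeZero V} (h : GraphRel x y) : LeavittRel (wordAlg F x) (wordAlg F y)
  | cuntzKrieger (v : V) (hfin : (outEdges v).Finite) (hne : (outEdges v).Nonempty) :
      LeavittRel (wordAlg F (word (.vertex v)))
        (∑ e ∈ hfin.toFinset, wordAlg F (word (.edge e) * word (.ghost e)))

variable (V) in
/-- The algebra congruence generated by the defining relations: the ring congruence generated by all
scalar multiples of them. -/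
noncomputable def leavittCon : RingCon (FreeAlg F V) :=
  ringConGen fun a b => ∃ (c : F) (x y : FreeAlg F V), LeavittRel F x y ∧ a = c • x ∧ b = c • y

theorem leavittCon_smul (c : F) (a b : FreeAlg F V) (h : leavittCon F V a b) :
    leavittCon F V (c • a) (c • b) := by
  change RingConGen.Rel _ a b at h
  change RingConGen.Rel _ (c • a) (c • b)
  induction h with
  | of x y h =>
    obtain ⟨d, x, y, h, rfl, rfl⟩ := h
    exact .of _ _ ⟨c * d, x, y, h, (mul_smul _ _ _).symm, (mul_smul _ _ _).symm⟩
  | refl x => exact .refl _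
  | symm _ ih => exact ih.symm
  | trans _ _ ih₁ ih₂ => exact ih₁.trans ih₂
  | add _ _ ih₁ ih₂ => rw [smul_add, smul_add]; exact ih₁.add ih₂
  | mul _ h₂ ih₁ _ => rw [← smul_mul_assoc, ← smul_mul_assoc]; exact ih₁.mul h₂

variable (V) in
/-- The Leavitt path algebra `L_F(Γ)`. -/
def LeavittPathAlgebra : Type _ := (leavittCon F V).Quotient

namespace LeavittPathAlgebra

noncomputable instance : NonUnitalRing (LeavittPathAlgebra F V) :=
  inferInstanceAs (NonUnitalRing (leavittCon F V).Quotient)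

/-- The quotient map from the free algebra. -/
noncomputable def mk (a : FreeAlg F V) : LeavittPathAlgebra F V := RingCon.toQuotient (c := leavittCon F V) a

noncomputable instance : Module F (LeavittPathAlgebra F V) where
  smul := (leavittCon F V).smulAux (leavittCon_smul F)
  one_smul a := Quotient.inductionOn' a fun x => congrArg (mk F) (one_smul F x)
  mul_smul c d a := Quotient.inductionOn' a fun x => congrArg (mk F) (mul_smul c d x)
  smul_zero c := congrArg (mk F) (smul_zero c)
  smul_add c a b := Quotient.inductionOn₂' a b fun x y => congrArg (mk F) (smul_add c x y)
  add_smul c d a := Quotient.inductionOn' a fun x => congrArg (mk F) (add_smul c d x)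
  zero_smul a := Quotient.inductionOn' a fun x => congrArg (mk F) (zero_smul F x)

instance : IsScalarTower F (LeavittPathAlgebra F V) (LeavittPathAlgebra F V) where
  smul_assoc c a b := Quotient.inductionOn₂' a b fun x y => congrArg (mk F) (smul_mul_assoc c x y)

instance : SMulCommClass F (LeavittPathAlgebra F V) (LeavittPathAlgebra F V) where
  smul_comm c a b :=
    Quotient.inductionOn₂' a b fun x y => congrArg (mk F) (mul_smul_comm c x y).symm

/-- The generators of `L_F(Γ)`. -/
noncomputable def of (g : Gen V) : LeavittPathAlgebra F V := mk F (wordAlg F (word g))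

end LeavittPathAlgebra

variable (V) in
/-- The Leavitt inverse semigroup `LI(Γ)`: the multiplicative subsemigroup with zero of `L_F(Γ)`
generated by the vertices, edges and ghost edges. -/
noncomputable def LI : Subsemigroup (LeavittPathAlgebra F V) :=
  Subsemigroup.closure (insert 0 (Set.range (LeavittPathAlgebra.of F (V := V))))

/-- The generators of `LI(Γ)`. -/
noncomputable def LI.of (g : Gen V) : LI F V :=
  ⟨LeavittPathAlgebra.of F g, Subsemigroup.subset_closure (Set.mem_insert_of_mem _ ⟨g, rfl⟩)⟩

end Algebra

/-- A semigroup is inverse if every element `a` has a unique inverse `b`. -/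
def IsInverseSemigroup (S : Type*) [Semigroup S] : Prop :=
  ∀ a : S, ∃! b : S, a * b * a = a ∧ b * a * b = b

section CanonicalForms

variable {V : Type u} [Quiver.{w} V]

/-- The last edge of a directed path, if the path is not empty. -/
def lastEdge {a : V} : ∀ {b : V}, Path a b → Option (Total V)
  | _, .nil => none
  | _, .cons _ e => some ⟨_, _, e⟩

/-- The value of a directed path `p = e₁ ⋯ eₙ` in a semigroup generated by the vertices, edges and
ghost edges: `s(p) e₁ ⋯ eₙ`, which is `e₁ ⋯ eₙ` if `n ≥ 1` and relation (1) holds. -/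
def pathVal {S : Type*} [Mul S] (g : Gen V → S) {a : V} : ∀ {b : V}, Path a b → S
  | _, .nil => g (.vertex a)
  | _, .cons p e => pathVal g p * g (.edge ⟨_, _, e⟩)

/-- The value of `p* = eₙ* ⋯ e₁*`, where `p = e₁ ⋯ eₙ`: this is `eₙ* ⋯ e₁* s(p)`. -/
def ghostVal {S : Type*} [Mul S] (g : Gen V → S) {a : V} : ∀ {b : V}, Path a b → S
  | _, .nil => g (.vertex a)
  | _, .cons p e => g (.ghost ⟨_, _, e⟩) * ghostVal g p

variable (V) in
/-- Pairs `(p, q)` of (possibly empty) directed paths with `r(p) = r(q)`. -/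
structure PathPair : Type max u w where
  {source₁ : V}
  {source₂ : V}
  {range : V}
  p : Path source₁ range
  q : Path source₂ range

namespace PathPair

/-- The element `pq*`. -/
def val {S : Type*} [Mul S] (g : Gen V → S) (t : PathPair V) : S := pathVal g t.p * ghostVal g t.q

/-- Form (a): `p` and `q` do not end in the same edge (in particular, this holds if one of them is
empty). -/
def FormA (t : PathPair V) : Prop := ¬ ∃ e, lastEdge t.p = some e ∧ lastEdge t.q = some e

/-- Form (b): `p = p'e` and `q = q'e`, where the out-degree of `s(e)` is at least `2`. -/
def FormB (t : PathPair V) : Prop :=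
  ∃ (v : V) (p' : Path t.source₁ v) (q' : Path t.source₂ v) (e : v ⟶ t.range),
    t.p = p'.cons e ∧ t.q = q'.cons e ∧ 2 ≤ (outEdges v).encard

/-- `pq*` is in canonical form. -/
def IsCanonical (t : PathPair V) : Prop := t.FormA ∨ t.FormB

end PathPair

end CanonicalForms

end LeavittGraph

/-! Relations (1)-(4) reduce every word to zero or to some `pq*`. By (v), a common last edge of `p`
and `q` can be cancelled when its source has out-degree 1, so canonical forms suffice in both
semigroups.

That they are distinct is seen in one faithful model by partial bijections of `V × ℕ × ℤ`. Over a
vertex that is not a sink, the copy of `ℕ` is split into copies of `ℕ`, one for each outgoing edge.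
An edge `e` maps its own piece onto the whole copy at `r(e)` and lowers the integer by one; `e*`
acts as the inverse. A point thus knows which path it can follow, and the integer records lengths.
Form (b) cannot be shortened, because a second edge at `s(e)` provides points where `p'q'*` is
defined and `p'ee*q'*` is not (`eq_of_val_eq_of_length_le`).

The pieces partition each non-sink vertex, so the induced operators on functions with values in `F`
satisfy (5) and represent `L_F(Γ)`. On the image of `L(Γ)` this representation recovers the faithful
action, hence `L(Γ)` embeds in `L_F(Γ)`, with image `LI(Γ)`. Inverses are unique among partial
bijections, and that of `pq*` is `qp*`; this makes both semigroups inverse. -/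

namespace LeavittGraph

open Quiver

universe u w

/-! ### Reduction of words to canonical form -/

section Words

variable {V : Type u} [Quiver.{w} V] {S : Type*} [SemigroupWithZero S]

/-- The extension of a map from the generators to a semigroup with zero to all words. -/
def evalWord (g : Gen V → S) : FreeZero V → S :=
  WithZero.recZeroCoe 0 (FreeSemigroup.lift g)

@[simp] theorem evalWord_zero (g : Gen V → S) : evalWord g 0 = 0 := rfl

@[simp] theorem evalWord_word (g : Gen V → S) (a : Gen V) : evalWord g (word a) = g a := rfl

@[simp] theorem evalWord_mul (g : Gen V → S) (x y : FreeZero V) :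
    evalWord g (x * y) = evalWord g x * evalWord g y := by
  induction x using WithZero.recZeroCoe with
  | zero => simp
  | coe x =>
    induction y using WithZero.recZeroCoe with
    | zero => simp
    | coe y => exact (FreeSemigroup.lift g).map_mul x y

theorem FreeZero.induction {P : FreeZero V → Prop} (zero : P 0) (word_one : ∀ a, P (word a))
    (word_mul : ∀ a x, P x → P (word a * x)) (x : FreeZero V) : P x := by
  induction x using WithZero.recZeroCoe with
  | zero => exact zero
  | coe x =>
    exact FreeSemigroup.recOnMul (C := fun x : FreeSemigroup (Gen V) => P (x : FreeZero V)) x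
      word_one fun a x _ hx => word_mul a (x : FreeZero V) hx

/-- The generators `g` of a semigroup with zero satisfy the defining relations of `L(Γ)`. -/
def SatisfiesLRel (g : Gen V → S) : Prop :=
  ∀ x y : FreeZero V, LRel x y → evalWord g x = evalWord g y

/-- The homomorphism from `L(Γ)` given by generators that satisfy the defining relations. -/
def LSemigroup.lift (g : Gen V → S) (hg : SatisfiesLRel g) : LSemigroup V →ₙ* S where
  toFun := Quotient.lift (evalWord g) fun x y h =>
    (Con.conGen_le (c := { r := fun x y => evalWord g x = evalWord g y
                           iseqv := ⟨fun _ => rfl, Eq.symm, Eq.trans⟩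
                           mul' := fun h₁ h₂ => by
                            rw [evalWord_mul, evalWord_mul, h₁, h₂] }) |>.2 hg) h
  map_mul' a b := Quotient.inductionOn₂' a b fun x y => evalWord_mul g x y

theorem LSemigroup.mk_surjective : Function.Surjective (LSemigroup.mk V) := Quotient.mk_surjective

theorem LSemigroup.mk_mul (x y : FreeZero V) : mk V (x * y) = mk V x * mk V y := rfl

theorem LSemigroup.mk_eq_evalWord (x : FreeZero V) : mk V x = evalWord of x := by
  induction x using FreeZero.induction with
  | zero => rfl
  | word_one a => rfl
  | word_mul a x ih => rw [evalWord_mul, ← ih]; rfl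

theorem LSemigroup.satisfiesLRel_of : SatisfiesLRel (LSemigroup.of (V := V)) := fun x y h => by
  rw [← mk_eq_evalWord, ← mk_eq_evalWord]
  exact Quotient.sound (ConGen.Rel.of _ _ h)

theorem map_pathVal {S T F : Type*} [Mul S] [Mul T] [FunLike F S T] [MulHomClass F S T]
    (f : F) (g : Gen V → S) {a b : V} (p : Path a b) :
    f (pathVal g p) = pathVal (fun x => f (g x)) p := by
  induction p with
  | nil => rfl
  | cons p e ih => rw [pathVal, map_mul, ih]; rfl

theorem map_ghostVal {S T F : Type*} [Mul S] [Mul T] [FunLike F S T] [MulHomClass F S T]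
    (f : F) (g : Gen V → S) {a b : V} (p : Path a b) :
    f (ghostVal g p) = ghostVal (fun x => f (g x)) p := by
  induction p with
  | nil => rfl
  | cons p e ih => rw [ghostVal, map_mul, ih]; rfl

theorem PathPair.map_val {S T F : Type*} [Mul S] [Mul T] [FunLike F S T] [MulHomClass F S T]
    (f : F) (g : Gen V → S) (t : PathPair V) : f (t.val g) = t.val (fun x => f (g x)) := by
  rw [val, map_mul, map_pathVal, map_ghostVal]; rfl

namespace SatisfiesLRel

variable {g : Gen V → S} (hg : SatisfiesLRel g)
include hg

theorem source_mul (x : Gen V) : g (.vertex x.source) * g x = g x := by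
  simpa using hg _ _ (.graph (.source_mul x))

theorem mul_range (x : Gen V) : g x * g (.vertex x.range) = g x := by
  simpa using hg _ _ (.graph (.mul_range x))

theorem vertex_mul_vertex {v v' : V} (h : v ≠ v') : g (.vertex v) * g (.vertex v') = 0 := by
  simpa using hg _ _ (.graph (.vertex_mul_vertex v v' h))

theorem mul_eq_zero {x y : Gen V} (h : x.range ≠ y.source) : g x * g y = 0 := by
  rw [← hg.mul_range x, ← hg.source_mul y, mul_assoc, ← mul_assoc (g (.vertex _)),
    hg.vertex_mul_vertex h, zero_mul, mul_zero]

theorem ghost_mul_edge {e f : Total V} (h : e ≠ f) : g (.ghost e) * g (.edge f) = 0 := by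
  simpa using hg _ _ (.graph (.ghost_mul_edge e f h))

theorem ghost_mul_self (e : Total V) : g (.ghost e) * g (.edge e) = g (.vertex e.right) := by
  simpa using hg _ _ (.graph (.ghost_mul_self e))

theorem edge_mul_ghost {e : Total V} (h : (outEdges e.left).encard = 1) :
    g (.edge e) * g (.ghost e) = g (.vertex e.left) := by
  simpa using hg _ _ (.outDegree_one e.left e h rfl)

theorem vertex_mul_pathVal {a b : V} (p : Path a b) :
    g (.vertex a) * pathVal g p = pathVal g p := by
  induction p with
  | nil => exact hg.source_mul (.vertex a)
  | cons p e ih => rw [pathVal, ← mul_assoc, ih]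

theorem pathVal_mul_vertex {a b : V} (p : Path a b) :
    pathVal g p * g (.vertex b) = pathVal g p := by
  cases p with
  | nil => exact hg.source_mul (.vertex a)
  | cons p e => rw [pathVal, mul_assoc]; congr 1; exact hg.mul_range (.edge _)

theorem vertex_mul_ghostVal {a b : V} (p : Path a b) :
    g (.vertex b) * ghostVal g p = ghostVal g p := by
  cases p with
  | nil => exact hg.source_mul (.vertex a)
  | cons p e => rw [ghostVal, ← mul_assoc]; congr 1; exact hg.source_mul (.ghost ⟨_, _, e⟩)

theorem pathVal_comp {a b c : V} (p : Path a b) (q : Path b c) :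
    pathVal g (p.comp q) = pathVal g p * pathVal g q := by
  induction q with
  | nil => exact (hg.pathVal_mul_vertex p).symm
  | cons q e ih => rw [Path.comp_cons, pathVal, ih, mul_assoc]; rfl

theorem pathVal_toPath {a b : V} (e : a ⟶ b) :
    pathVal g e.toPath = g (.edge ⟨a, b, e⟩) := hg.source_mul (.edge ⟨a, b, e⟩)

theorem gen_mul_pathVal_eq_zero {x : Gen V} {a b : V} (h : x.range ≠ a) (p : Path a b) :
    g x * pathVal g p = 0 := by
  rw [← hg.vertex_mul_pathVal, ← mul_assoc, hg.mul_eq_zero (y := .vertex a) h, zero_mul]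

/-- When the vertices match, an edge is prepended to `p`, while a ghost edge cancels against the
first edge of `p`, annihilates it, or, if `p` is empty, is absorbed into `q*`. -/
theorem gen_mul_val (x : Gen V) (t : PathPair V) :
    g x * t.val g = 0 ∨ ∃ t' : PathPair V, g x * t.val g = t'.val g := by
  obtain ⟨p, q⟩ := t
  rename_i a b c
  by_cases hx : x.range = a
  swap
  · left
    rw [PathPair.val, ← mul_assoc, hg.gen_mul_pathVal_eq_zero hx, zero_mul]
  cases x with
  | vertex v =>
    obtain rfl : v = a := hx
    right
    exact ⟨⟨p, q⟩, by rw [PathPair.val, ← mul_assoc, hg.vertex_mul_pathVal]⟩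
  | edge e =>
    obtain ⟨v, v', e⟩ := e
    obtain rfl : v' = a := hx
    right
    exact ⟨⟨e.toPath.comp p, q⟩, by
      rw [PathPair.val, PathPair.val, hg.pathVal_comp, hg.pathVal_toPath, mul_assoc]⟩
  | ghost e =>
    obtain ⟨v, v', e⟩ := e
    obtain rfl : v = a := hx
    -- Paths grow at their end, but `e*` meets the first edge of `p`; splitting by length exposes
    -- that edge.
    rcases hp : p.length with _ | n
    · obtain rfl := Path.eq_of_length_zero p hp
      obtain rfl := Path.eq_nil_of_length_zero p hp
      right
      refine ⟨⟨.nil, q.cons e⟩, ?_⟩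
      simp only [PathPair.val, pathVal, ghostVal]
      rw [← mul_assoc, ← mul_assoc]
      exact congrArg (· * ghostVal g q) ((hg.mul_range (.ghost ⟨v, v', e⟩)).trans
        (hg.source_mul (.ghost ⟨v, v', e⟩)).symm)
    · obtain ⟨d, f, p', -, rfl⟩ := p.eq_toPath_comp_of_length_eq_succ hp
      by_cases hef : (⟨v, v', e⟩ : Total V) = ⟨v, d, f⟩
      · right
        cases hef
        refine ⟨⟨p', q⟩, ?_⟩
        simp only [PathPair.val]
        rw [hg.pathVal_comp, hg.pathVal_toPath, ← mul_assoc, ← mul_assoc,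
          hg.ghost_mul_self, hg.vertex_mul_pathVal]
      · left
        rw [PathPair.val, hg.pathVal_comp, hg.pathVal_toPath, ← mul_assoc, ← mul_assoc,
          hg.ghost_mul_edge hef, zero_mul, zero_mul]

theorem exists_val_eq_gen (x : Gen V) : ∃ t : PathPair V, g x = t.val g := by
  cases x with
  | vertex v => exact ⟨⟨.nil (a := v), .nil⟩, (hg.source_mul (.vertex v)).symm⟩
  | edge e =>
    refine ⟨⟨e.hom.toPath, .nil⟩, ?_⟩
    rw [PathPair.val, hg.pathVal_toPath]
    exact (hg.mul_range (.edge e)).symm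
  | ghost e =>
    refine ⟨⟨.nil, e.hom.toPath⟩, ?_⟩
    exact (congrArg₂ (· * ·) rfl (hg.mul_range (.ghost e))).trans (hg.source_mul (.ghost e)) |>.symm

theorem evalWord_eq_zero_or_val (x : FreeZero V) :
    evalWord g x = 0 ∨ ∃ t : PathPair V, evalWord g x = t.val g := by
  induction x using FreeZero.induction with
  | zero => exact .inl rfl
  | word_one a => exact .inr (hg.exists_val_eq_gen a)
  | word_mul a x ih =>
    rw [evalWord_mul, evalWord_word]
    obtain h | ⟨t, h⟩ := ih
    · left; rw [h, mul_zero]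
    · rw [h]; exact hg.gen_mul_val a t

/-- Removing a common last edge that is the only edge with its source does not change the value. -/
theorem val_cons_cons {a b c d : V} (p : Path a c) (q : Path b c) (e : c ⟶ d)
    (h : (outEdges c).encard = 1) :
    PathPair.val g ⟨p.cons e, q.cons e⟩ = PathPair.val g ⟨p, q⟩ := by
  simp only [PathPair.val, pathVal, ghostVal]
  rw [mul_assoc, ← mul_assoc (g (.edge _)), hg.edge_mul_ghost h, hg.vertex_mul_ghostVal]

/-- Common last edges are stripped one by one. The process stops at form (a) when the last edges
differ or a path is empty, and at form (b) when the source of the common edge has out-degree at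
least 2. -/
theorem exists_canonical (t : PathPair V) :
    ∃ t' : PathPair V, t'.IsCanonical ∧ t.val g = t'.val g := by
  obtain ⟨p, q⟩ := t
  rename_i a b c
  induction p with
  | nil => exact ⟨⟨.nil, q⟩, .inl (by simp [PathPair.FormA, lastEdge]), rfl⟩
  | @cons c d p e ih =>
    by_cases hA : PathPair.FormA ⟨p.cons e, q⟩
    · exact ⟨_, .inl hA, rfl⟩
    · obtain ⟨f, hf, hf'⟩ := not_not.1 hA
      cases q with
      | nil => cases hf'
      | cons q e' =>
        cases hf
        cases hf'
        by_cases hc : 2 ≤ (outEdges c).encard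
        · exact ⟨_, .inr ⟨c, p, q, e, rfl, rfl, hc⟩, rfl⟩
        · obtain ⟨t', ht', h⟩ := ih q
          refine ⟨t', ht', (hg.val_cons_cons p q e ?_).trans h⟩
          have h1 : 1 ≤ (outEdges c).encard :=
            Set.one_le_encard_iff_nonempty.2 ⟨⟨c, d, e⟩, rfl⟩
          refine le_antisymm ?_ h1
          exact Order.le_of_lt_add_one (by rw [one_add_one_eq_two]; exact not_le.1 hc)

end SatisfiesLRel

theorem LSemigroup.eq_zero_or_canonical (x : LSemigroup V) :
    x = 0 ∨ ∃ t : PathPair V, t.IsCanonical ∧ x = t.val LSemigroup.of := by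
  obtain ⟨x, rfl⟩ := LSemigroup.mk_surjective x
  rw [mk_eq_evalWord]
  obtain h | ⟨t, h⟩ := satisfiesLRel_of.evalWord_eq_zero_or_val x
  · exact .inl h
  · rw [h]; exact .inr (satisfiesLRel_of.exists_canonical t)

end Words

/-! ### Partial bijections and their linear action on functions -/

section PartialBijections

variable {α : Type*}

/-- Partial bijections form a semigroup with zero; they are composed from left to right. -/
instance : SemigroupWithZero (α ≃. α) where
  mul f g := f.trans g
  mul_assoc := PEquiv.trans_assoc
  zero := ⊥
  zero_mul := PEquiv.bot_trans
  mul_zero := PEquiv.trans_bot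

theorem mem_pequiv_mul {f g : α ≃. α} {a c : α} : c ∈ (f * g) a ↔ ∃ b, b ∈ f a ∧ c ∈ g b :=
  PEquiv.mem_trans f g a c

theorem pequiv_symm_mul (f g : α ≃. α) : (f * g).symm = g.symm * f.symm :=
  PEquiv.symm_trans_rev f g

theorem not_mem_pequiv_zero {a b : α} : b ∉ (0 : α ≃. α) a := by
  change b ∉ (⊥ : α ≃. α) a
  simp

theorem pequiv_ext {f g : α ≃. α} (h : ∀ a b, b ∈ f a ↔ b ∈ g a) : f = g :=
  PEquiv.ext fun a => Option.ext fun b => h a b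

theorem pequiv_mul_symm_mul (f : α ≃. α) : f * f.symm * f = f := by
  refine pequiv_ext fun a b => ?_
  simp only [mem_pequiv_mul, PEquiv.mem_iff_mem]
  constructor
  · rintro ⟨c, ⟨d, h₁, h₂⟩, h₃⟩
    rwa [f.inj h₁ h₂]
  · exact fun h => ⟨a, ⟨b, h, h⟩, h⟩

/-- A point traced through `g`, `f`, `g` must return to its starting point: single-valuedness
identifies the first image with the last, and injectivity the corresponding arguments. -/
theorem pequiv_eq_symm {f g : α ≃. α} (h₁ : f * g * f = f) (h₂ : g * f * g = g) : g = f.symm := by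
  refine pequiv_ext fun a b => ?_
  rw [PEquiv.mem_iff_mem]
  constructor
  · intro h
    have h' := h
    rw [← h₂] at h'
    simp only [mem_pequiv_mul] at h'
    obtain ⟨d, ⟨c, hc, hd⟩, hb⟩ := h'
    obtain rfl := Option.mem_unique h hc
    rwa [g.inj h hb]
  · intro h
    have h' := h
    rw [← h₁] at h'
    simp only [mem_pequiv_mul] at h'
    obtain ⟨d, ⟨c, hc, hd⟩, hb⟩ := h'
    obtain rfl := Option.mem_unique h hc
    rwa [f.inj h hb]

variable (F : Type*) [Field F]

/-- A partial bijection of a set acts linearly on the functions on the set. -/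
noncomputable def pullback (f : α ≃. α) : Module.End F (α → F) where
  toFun φ a := (f a).elim 0 φ
  map_add' φ ψ := by
    funext a
    change (f a).elim 0 (φ + ψ) = (f a).elim 0 φ + (f a).elim 0 ψ
    cases f a <;> simp
  map_smul' c φ := by
    funext a
    change (f a).elim 0 (c • φ) = c * (f a).elim 0 φ
    cases f a <;> simp

variable {F}

theorem pullback_of_mem {f : α ≃. α} {a b : α} (h : b ∈ f a) (φ : α → F) :
    pullback F f φ a = φ b := by
  change (f a).elim 0 φ = φ b
  rw [Option.mem_def.1 h]; rfl

theorem pullback_of_forall_not_mem {f : α ≃. α} {a : α} (h : ∀ b, b ∉ f a) (φ : α → F) :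
    pullback F f φ a = 0 := by
  change (f a).elim 0 φ = 0
  rw [Option.eq_none_iff_forall_not_mem.2 h]; rfl

variable (F)

theorem pullback_zero : pullback F (0 : α ≃. α) = 0 :=
  LinearMap.ext fun φ => funext fun _ => pullback_of_forall_not_mem (fun _ => not_mem_pequiv_zero) φ

theorem pullback_mul (f g : α ≃. α) : pullback F (f * g) = pullback F f * pullback F g := by
  ext φ a
  change (f.trans g a).elim 0 φ = (f a).elim 0 fun b => (g b).elim 0 φ
  change ((f a).bind g).elim 0 φ = _
  cases f a <;> rfl

/-- The operator applied to the indicator function of a point `b` shows which point, if any, is sent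
to `b`. -/
theorem pullback_injective : Function.Injective (pullback F (α := α)) := by
  classical
  intro f g h
  have key : ∀ (f : α ≃. α) (a b : α), b ∈ f a ↔ pullback F f (Pi.single b 1) a = 1 := by
    intro f a b
    change _ ↔ (f a).elim 0 (Pi.single b 1) = 1
    cases f a with
    | none => simp
    | some c =>
      by_cases hc : c = b
      · simp [hc]
      · simp [hc]
  exact pequiv_ext fun a b => by rw [key, key, h]

end PartialBijections

/-! ### The model on `V × ℕ × ℤ` -/

section Branching

variable (V : Type u) [Quiver.{w} V]

/-- A copy of `ℕ` at each vertex, which for each vertex that is not a sink is the disjoint union of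
the images of the injective maps `child e`, for the edges `e` with source `v`. -/
structure Branching where
  child : Total V → ℕ → ℕ
  child_inj : ∀ (e f : Total V) (m n : ℕ), e.left = f.left → child e m = child f n → e = f ∧ m = n
  child_surj : ∀ (v : V), (outEdges v).Nonempty → ∀ n, ∃ e ∈ outEdges v, ∃ m, child e m = n

variable {V} in
-- The product of a nonempty finite set with `ℕ` is countably infinite, hence in bijection with `ℕ`.
theorem Branching.nonempty (hΓ : ∀ v : V, (outEdges v).Finite) : Nonempty (Branching V) := by
  have key : ∀ v : V, ∃ β : outEdges v × ℕ → ℕ, Function.Injective β ∧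
      ((outEdges v).Nonempty → Function.Surjective β) := by
    intro v
    have := (hΓ v).to_subtype
    obtain h | h := (outEdges v).eq_empty_or_nonempty
    -- At a sink the domain is empty, so any map is injective.
    · exact ⟨fun _ => 0, fun x => by simp [h], fun h' => by simp [h] at h'⟩
    · have := h.to_subtype
      have : Nonempty (outEdges v × ℕ ≃ ℕ) := nonempty_equiv_of_countable
      obtain ⟨β⟩ := this
      exact ⟨β, β.injective, fun _ => β.surjective⟩
  choose β hinj hsurj using key
  refine ⟨⟨fun e n => β e.left (⟨e, rfl⟩, n), ?_, ?_⟩⟩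
  · intro e f m n hef h
    -- The vertex is generalised so that both edges are indexed over the same `v`, although `e.left`
    -- and `f.left` are only propositionally equal.
    have h' : ∀ v (he : e ∈ outEdges v) (hf : f ∈ outEdges v),
        β v (⟨e, he⟩, m) = β v (⟨f, hf⟩, n) → e = f ∧ m = n := by
      intro v he hf h
      have := hinj v h
      simpa using this
    refine h' e.left rfl hef.symm (h.trans ?_)
    have h'' : ∀ v (hf : f.left = v), β f.left (⟨f, rfl⟩, n) = β v (⟨f, hf⟩, n) := by
      rintro v rfl; rfl
    exact h'' _ _
  · intro v hv n
    obtain ⟨⟨⟨e, he⟩, m⟩, h⟩ := hsurj v hv n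
    cases he
    exact ⟨e, rfl, m, h⟩

namespace Branching

variable {V} (B : Branching V)

/-- The partial bijection from the copy of `ℕ × ℤ` at the source of an edge to that at its range;
the integer counts edges. -/
noncomputable def edgeMap (e : Total V) : (V × ℕ × ℤ) ≃. (V × ℕ × ℤ) := by
  classical
  exact
  { toFun := fun y => if h : ∃ m, y.1 = e.left ∧ y.2.1 = B.child e m then
      some (e.right, h.choose, y.2.2 - 1) else none
    invFun := fun z => if z.1 = e.right then
      some (e.left, B.child e z.2.1, z.2.2 + 1) else none
    inv := by
      rintro ⟨v, n, d⟩ ⟨v', n', d'⟩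
      by_cases h : ∃ m, v = e.left ∧ n = B.child e m
      · have hs := h.choose_spec
        -- Injectivity of `child e` makes the chosen preimage the only one.
        have hu : ∀ m, n = B.child e m → m = h.choose := fun m hm =>
          (B.child_inj e e _ _ rfl (hm.symm.trans hs.2)).2
        simp only [h, dif_pos]
        by_cases hv : v' = e.right
        · simp only [hv, if_true, Option.some.injEq, Prod.mk.injEq, true_and]
          constructor
          · rintro ⟨h₁, h₂, h₃⟩
            exact ⟨(hu _ h₂.symm).symm, by omega⟩
          · rintro ⟨h₁, h₃⟩
            exact ⟨hs.1.symm, by rw [hs.2, h₁], by omega⟩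
        · simp [hv, Ne.symm hv]
      · simp only [h, dif_neg, not_false_eq_true]
        simp only [reduceCtorEq, iff_false]
        split_ifs with hv
        · simp only [Option.some.injEq, Prod.mk.injEq]
          rintro ⟨h₁, h₂, h₃⟩
          exact h ⟨n', h₁.symm, h₂.symm⟩
        · simp }

/-- Read off from the inverse map, whose formula involves no choice. -/
theorem mem_edgeMap {e : Total V} {y z : V × ℕ × ℤ} :
    z ∈ B.edgeMap e y ↔ z.1 = e.right ∧ y = (e.left, B.child e z.2.1, z.2.2 + 1) := by
  rw [← PEquiv.mem_iff_mem]
  change y ∈ @ite _ (z.1 = e.right) (Classical.propDecidable _)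
    (some (e.left, B.child e z.2.1, z.2.2 + 1)) none ↔ _
  split_ifs with h
  · simp [h, eq_comm]
  · simp [h]

/-- The partial bijections given by the generators. -/
noncomputable def gen : Gen V → ((V × ℕ × ℤ) ≃. (V × ℕ × ℤ))
  | .vertex v => by classical exact PEquiv.ofSet {y | y.1 = v}
  | .edge e => B.edgeMap e
  | .ghost e => (B.edgeMap e).symm

theorem mem_gen_vertex {v : V} {y z : V × ℕ × ℤ} :
    z ∈ B.gen (.vertex v) y ↔ y = z ∧ y.1 = v := by
  refine (@PEquiv.mem_ofSet_iff _ {y : V × ℕ × ℤ | y.1 = v} (_) z y).trans ?_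
  rw [Set.mem_ofPred_eq]
  grind

theorem mem_gen_edge {e : Total V} {y z : V × ℕ × ℤ} :
    z ∈ B.gen (.edge e) y ↔ z.1 = e.right ∧ y = (e.left, B.child e z.2.1, z.2.2 + 1) :=
  B.mem_edgeMap

theorem mem_gen_ghost {e : Total V} {y z : V × ℕ × ℤ} :
    z ∈ B.gen (.ghost e) y ↔ y ∈ B.gen (.edge e) z := PEquiv.mem_iff_mem _

theorem mem_gen {x : Gen V} {y z : V × ℕ × ℤ} (h : z ∈ B.gen x y) :
    y.1 = x.source ∧ z.1 = x.range := by
  cases x with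
  | vertex v => rw [mem_gen_vertex] at h; obtain ⟨rfl, h⟩ := h; exact ⟨h, h⟩
  | edge e => rw [mem_gen_edge] at h; obtain ⟨h, rfl⟩ := h; exact ⟨rfl, h⟩
  | ghost e => rw [mem_gen_ghost, mem_gen_edge] at h; obtain ⟨h, rfl⟩ := h; exact ⟨h, rfl⟩

/-- The pieces of distinct edges with the same source are disjoint. This gives (3) and makes paths
deterministic. -/
theorem edge_unique {e f : Total V} {y z z' : V × ℕ × ℤ} (h : z ∈ B.gen (.edge e) y)
    (h' : z' ∈ B.gen (.edge f) y) : e = f := by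
  rw [mem_gen_edge] at h h'
  obtain ⟨-, rfl⟩ := h
  have := h'.2
  simp only [Prod.mk.injEq] at this
  exact (B.child_inj _ _ _ _ this.1 this.2.1).1

theorem exists_mem_gen_edge (e : Total V) {z : V × ℕ × ℤ} (h : z.1 = e.right) :
    ∃ y, z ∈ B.gen (.edge e) y := ⟨_, B.mem_gen_edge.2 ⟨h, rfl⟩⟩

/-- The pieces cover the copy at a non-sink. Together with disjointness this underlies both (v) and
(5). -/
theorem exists_edge {v : V} (hv : (outEdges v).Nonempty) {y : V × ℕ × ℤ} (hy : y.1 = v) :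
    ∃ e ∈ outEdges v, ∃ z, z ∈ B.gen (.edge e) y := by
  obtain ⟨e, he, m, hm⟩ := B.child_surj v hv y.2.1
  refine ⟨e, he, (e.right, m, y.2.2 - 1), B.mem_gen_edge.2 ⟨rfl, ?_⟩⟩
  cases he
  ext <;> simp [hm, hy]

theorem mem_edge_mul_ghost {e : Total V} {y w : V × ℕ × ℤ} :
    w ∈ (B.gen (.edge e) * B.gen (.ghost e)) y ↔ y = w ∧ ∃ z, z ∈ B.gen (.edge e) y := by
  simp only [mem_pequiv_mul, mem_gen_ghost]
  constructor
  · rintro ⟨z, h, h'⟩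
    exact ⟨(B.gen (.edge e)).inj h h', z, h⟩
  · rintro ⟨rfl, z, h⟩
    exact ⟨z, h, h⟩

theorem evalWord_graphRel {x y : FreeZero V} (h : GraphRel x y) :
    evalWord B.gen x = evalWord B.gen y := by
  refine pequiv_ext fun a b => ?_
  cases h with
  | source_mul g =>
    simp only [evalWord_mul, evalWord_word, mem_pequiv_mul, mem_gen_vertex]
    exact ⟨by rintro ⟨_, ⟨rfl, _⟩, h⟩; exact h, fun h => ⟨a, ⟨rfl, (B.mem_gen h).1⟩, h⟩⟩
  | mul_range g =>
    simp only [evalWord_mul, evalWord_word, mem_pequiv_mul, mem_gen_vertex]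
    exact ⟨by rintro ⟨_, h, rfl, _⟩; exact h, fun h => ⟨b, h, rfl, (B.mem_gen h).2⟩⟩
  | vertex_mul_vertex v v' h =>
    simp only [evalWord_mul, evalWord_word, mem_pequiv_mul, mem_gen_vertex, evalWord_zero,
      not_mem_pequiv_zero, iff_false]
    rintro ⟨_, ⟨rfl, h₁⟩, -, h₂⟩
    exact h (h₁.symm.trans h₂)
  | ghost_mul_edge e f h =>
    simp only [evalWord_mul, evalWord_word, mem_pequiv_mul, mem_gen_ghost, evalWord_zero,
      not_mem_pequiv_zero, iff_false]
    rintro ⟨_, h₁, h₂⟩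
    exact h (B.edge_unique h₁ h₂)
  | ghost_mul_self e =>
    simp only [evalWord_mul, evalWord_word, mem_pequiv_mul, mem_gen_ghost, mem_gen_vertex]
    constructor
    · rintro ⟨_, h₁, h₂⟩
      exact ⟨Option.mem_unique h₁ h₂, (B.mem_gen h₁).2⟩
    · rintro ⟨rfl, h⟩
      obtain ⟨y, hy⟩ := B.exists_mem_gen_edge e h
      exact ⟨y, hy, hy⟩

theorem satisfiesLRel : SatisfiesLRel B.gen := by
  intro x y h
  cases h with
  | graph h => exact B.evalWord_graphRel h
  | outDegree_one v e hv he =>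
    refine pequiv_ext fun a b => ?_
    rw [evalWord_mul, evalWord_word, evalWord_word, evalWord_word, mem_edge_mul_ghost,
      mem_gen_vertex]
    refine and_congr_right fun _ => ⟨fun ⟨z, h⟩ => (B.mem_gen h).1.trans he, fun h => ?_⟩
    -- Some outgoing edge is defined at the point, and out-degree 1 forces it to be `e`.
    obtain ⟨f, hf, z, hz⟩ := B.exists_edge ⟨e, he⟩ h
    rw [Set.encard_eq_one] at hv
    obtain ⟨e', hv⟩ := hv
    rw [hv] at he hf
    cases he; cases hf
    exact ⟨z, hz⟩

/-! ### Separating canonical forms by their action -/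

section Paths

theorem mem_pathVal_cons {a b c : V} {p : Path a b} {e : b ⟶ c} {y z : V × ℕ × ℤ} :
    z ∈ pathVal B.gen (p.cons e) y ↔
      ∃ x, x ∈ pathVal B.gen p y ∧ z ∈ B.gen (.edge ⟨b, c, e⟩) x := mem_pequiv_mul

theorem mem_pathVal_comp {a b c : V} {p : Path a b} {q : Path b c} {y z : V × ℕ × ℤ} :
    z ∈ pathVal B.gen (p.comp q) y ↔
      ∃ x, x ∈ pathVal B.gen p y ∧ z ∈ pathVal B.gen q x := by
  rw [B.satisfiesLRel.pathVal_comp, mem_pequiv_mul]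

/-- The integer coordinate measures length. Without it, a cycle through vertices of out-degree 1
could act as the identity. -/
theorem mem_pathVal {a b : V} {p : Path a b} {y z : V × ℕ × ℤ} (h : z ∈ pathVal B.gen p y) :
    y.1 = a ∧ z.1 = b ∧ y.2.2 = z.2.2 + p.length := by
  induction p generalizing z with
  | nil => obtain ⟨rfl, ha⟩ := B.mem_gen_vertex.1 h; simp [ha]
  | cons p e ih =>
    obtain ⟨x, hx, hz⟩ := B.mem_pathVal_cons.1 h
    obtain ⟨h₁, h₂, h₃⟩ := ih hx
    obtain ⟨h₄, rfl⟩ := B.mem_gen_edge.1 hz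
    refine ⟨h₁, h₄, h₃.trans ?_⟩
    simp only [Path.length_cons]; push_cast; ring

theorem exists_mem_pathVal {a b : V} (p : Path a b) {z : V × ℕ × ℤ} (h : z.1 = b) :
    ∃ y, z ∈ pathVal B.gen p y := by
  induction p generalizing z with
  | nil => exact ⟨z, B.mem_gen_vertex.2 ⟨rfl, h⟩⟩
  | cons p e ih =>
    obtain ⟨x, hx⟩ := B.exists_mem_gen_edge ⟨_, _, e⟩ h
    obtain ⟨y, hy⟩ := ih (B.mem_gen hx).1
    exact ⟨y, B.mem_pathVal_cons.2 ⟨x, hy, hx⟩⟩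

/-- At each step the current point admits only one edge. The ranges are not known to agree
beforehand, hence the sigma type. -/
theorem path_unique {a b c : V} (p : Path a b) (q : Path a c) {y z w : V × ℕ × ℤ}
    (hp : z ∈ pathVal B.gen p y) (hq : w ∈ pathVal B.gen q y) (h : p.length = q.length) :
    (⟨b, p⟩ : Σ b, Path a b) = ⟨c, q⟩ := by
  induction p generalizing c z w with
  | nil =>
    cases q with
    | nil => rfl
    | cons q f => simp at h
  | cons p e ih =>
    cases q with
    | nil => simp at h
    | cons q f =>
      obtain ⟨x, hx, hz⟩ := B.mem_pathVal_cons.1 hp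
      obtain ⟨x', hx', hw⟩ := B.mem_pathVal_cons.1 hq
      cases ih q hx hx' (by simpa using h)
      obtain rfl := Option.mem_unique hx hx'
      cases B.edge_unique hz hw
      rfl

theorem exists_comp_eq {a b c : V} (p : Path a b) (q : Path a c) {y z w : V × ℕ × ℤ}
    (hp : z ∈ pathVal B.gen p y) (hq : w ∈ pathVal B.gen q y) (h : p.length ≤ q.length) :
    ∃ s : Path b c, q = p.comp s ∧ w ∈ pathVal B.gen s z := by
  induction q generalizing w with
  | nil =>
    cases B.path_unique p _ hp hq (Nat.le_zero.1 h)
    obtain rfl := Option.mem_unique hp hq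
    exact ⟨.nil, rfl, B.mem_gen_vertex.2 ⟨rfl, (B.mem_pathVal hp).1.symm ▸ (B.mem_pathVal hp).2.1⟩⟩
  | cons q f ih =>
    obtain h | h := Nat.lt_or_eq_of_le h
    · obtain ⟨x', hx', hw⟩ := B.mem_pathVal_cons.1 hq
      obtain ⟨s, rfl, hs⟩ := ih hx' (by simpa [Nat.lt_succ_iff] using h)
      exact ⟨s.cons f, rfl, B.mem_pathVal_cons.2 ⟨x', hs, hw⟩⟩
    · cases B.path_unique p _ hp hq h
      obtain rfl := Option.mem_unique hp hq
      exact ⟨.nil, rfl, B.mem_gen_vertex.2 ⟨rfl, (B.mem_pathVal hp).2.1⟩⟩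

theorem ghostVal_eq_symm {a b : V} (p : Path a b) :
    ghostVal B.gen p = (pathVal B.gen p).symm := by
  induction p with
  | nil => simp only [ghostVal, pathVal, gen, PEquiv.ofSet_symm]
  | cons p e ih => rw [ghostVal, pathVal, pequiv_symm_mul, ih]; rfl

theorem mem_val {t : PathPair V} {y w : V × ℕ × ℤ} :
    w ∈ t.val B.gen y ↔ ∃ z, z ∈ pathVal B.gen t.p y ∧ z ∈ pathVal B.gen t.q w := by
  rw [PathPair.val, ghostVal_eq_symm, mem_pequiv_mul]
  simp only [PEquiv.mem_iff_mem]

theorem val_symm (t : PathPair V) :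
    PathPair.val B.gen ⟨t.q, t.p⟩ = (t.val B.gen).symm := by
  rw [PathPair.val, PathPair.val, pequiv_symm_mul, ghostVal_eq_symm, ghostVal_eq_symm,
    PEquiv.symm_symm]

theorem exists_mem_val (t : PathPair V) {z : V × ℕ × ℤ} (h : z.1 = t.range) :
    ∃ y w, z ∈ pathVal B.gen t.p y ∧ z ∈ pathVal B.gen t.q w ∧ w ∈ t.val B.gen y := by
  obtain ⟨y, hy⟩ := B.exists_mem_pathVal t.p h
  obtain ⟨w, hw⟩ := B.exists_mem_pathVal t.q h
  exact ⟨y, w, hy, hw, B.mem_val.2 ⟨z, hy, hw⟩⟩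

theorem val_ne_zero (t : PathPair V) : t.val B.gen ≠ 0 := by
  intro h
  obtain ⟨y, w, -, -, hyw⟩ := B.exists_mem_val t (z := (t.range, 0, 0)) rfl
  rw [h] at hyw
  exact not_mem_pequiv_zero hyw

/-- Equal actions force `p' = ps` and `q' = qs` for a common path `s`. If `s` were nonempty, its
last edge would be common to `p'` and `q'`, which excludes form (a); in form (b), a point leaving
along another edge separates the two actions. -/
theorem eq_of_val_eq_of_length_le {t t' : PathPair V} (ht' : t'.IsCanonical)
    (h : t.val B.gen = t'.val B.gen) (hl : t.p.length ≤ t'.p.length) : t = t' := by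
  obtain ⟨y, w, hy, hw, hyw⟩ := B.exists_mem_val t' (z := (t'.range, 0, 0)) rfl
  rw [← h] at hyw
  obtain ⟨z, hz, hz'⟩ := B.mem_val.1 hyw
  obtain ⟨p, q⟩ := t
  obtain ⟨p', q'⟩ := t'
  rename_i a b c a' b' c'
  dsimp only at *
  have d₁ := B.mem_pathVal hy
  have d₂ := B.mem_pathVal hw
  have d₃ := B.mem_pathVal hz
  have d₄ := B.mem_pathVal hz'
  obtain rfl : a = a' := d₃.1.symm.trans d₁.1
  obtain rfl : b = b' := d₄.1.symm.trans d₂.1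
  obtain ⟨s, rfl, hs⟩ := B.exists_comp_eq p p' hz hy hl
  -- The integer coordinate of `z` equals both differences of lengths, for `p', p` and for `q', q`;
  -- so `q` is no longer than `q'`, and below `s` and `s'` have equal length.
  obtain ⟨s', rfl, hs'⟩ := B.exists_comp_eq q q' hz' hw (by omega)
  have hss := B.path_unique s s' hs hs' (by
    have := (B.mem_pathVal hs).2.2
    have := (B.mem_pathVal hs').2.2
    omega)
  cases hss
  cases s with
  | nil => rfl
  | @cons d _ s e =>
    exfalso
    obtain hA | ⟨v, p₁, q₁, e₁, hp, hq, hv⟩ := ht'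
    · exact hA ⟨⟨d, c', e⟩, rfl, rfl⟩
    · dsimp only [Path.comp_cons] at hp hq
      cases hp
      -- Form (b) supplies a second edge `f` with the same source as `e`.
      obtain ⟨⟨d', r, f⟩, hf, hne⟩ := Set.exists_ne_of_one_lt_encard
        (lt_of_lt_of_le (by norm_num) hv) (⟨d, c', e⟩ : Total V)
      obtain rfl : d' = d := hf
      obtain ⟨x, hx⟩ := B.exists_mem_gen_edge ⟨d', r, f⟩ (z := (r, 0, 0)) rfl
      -- The point `y'` follows `p`, `s` and then `f`. It lies in the domain of `pq*`, but the other
      -- element is defined only on points that follow `p`, `s` and then `e`.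
      obtain ⟨y', w', hy', hw', -⟩ := B.exists_mem_val ⟨p.comp s, q.comp s⟩ (B.mem_gen hx).1
      dsimp only at hy' hw'
      have hyw' : w' ∈ PathPair.val B.gen ⟨p, q⟩ y' := by
        obtain ⟨u, hu, hu'⟩ := B.mem_pathVal_comp.1 hy'
        obtain ⟨v, hv, hv'⟩ := B.mem_pathVal_comp.1 hw'
        obtain rfl := (pathVal B.gen s).inj hu' hv'
        exact B.mem_val.2 ⟨u, hu, hv⟩
      rw [h] at hyw'
      obtain ⟨z', hz', -⟩ := B.mem_val.1 hyw'
      obtain ⟨x', hx', hz'⟩ := B.mem_pathVal_cons.1 hz'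
      obtain rfl := Option.mem_unique hx' hy'
      exact hne (B.edge_unique hx hz')

theorem eq_of_val_eq {t t' : PathPair V} (ht : t.IsCanonical) (ht' : t'.IsCanonical)
    (h : t.val B.gen = t'.val B.gen) : t = t' := by
  obtain hl | hl := le_total t.p.length t'.p.length
  · exact B.eq_of_val_eq_of_length_le ht' h hl
  · exact (B.eq_of_val_eq_of_length_le ht h.symm hl).symm

end Paths

/-- The action of `L(Γ)` by partial bijections. -/
noncomputable def action : LSemigroup V →ₙ* ((V × ℕ × ℤ) ≃. (V × ℕ × ℤ)) :=
  LSemigroup.lift B.gen B.satisfiesLRel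

theorem action_val (t : PathPair V) : B.action (t.val LSemigroup.of) = t.val B.gen :=
  t.map_val B.action LSemigroup.of

theorem action_injective : Function.Injective B.action := by
  intro x y h
  obtain rfl | ⟨t, ht, rfl⟩ := LSemigroup.eq_zero_or_canonical x <;>
    obtain rfl | ⟨t', ht', rfl⟩ := LSemigroup.eq_zero_or_canonical y
  · rfl
  · rw [action_val] at h; exact (B.val_ne_zero t' h.symm).elim
  · rw [action_val] at h; exact (B.val_ne_zero t h).elim
  · rw [action_val, action_val] at h; rw [B.eq_of_val_eq ht ht' h]

end Branching

end Branching

/-! ### Representing the Leavitt path algebra -/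

section LeavittPathAlgebra

variable (F : Type*) [Field F] {V : Type u} [Quiver.{w} V]

theorem wordAlg_mul (x y : FreeZero V) : wordAlg F (x * y) = wordAlg F x * wordAlg F y := by
  induction x using WithZero.recZeroCoe with
  | zero => exact (zero_mul _).symm
  | coe x =>
    induction y using WithZero.recZeroCoe with
    | zero => exact (mul_zero _).symm
    | coe y =>
      refine Eq.trans ?_ (MonoidAlgebra.single_mul_single ..).symm
      rw [one_mul]; rfl

namespace LeavittPathAlgebra

theorem mk_wordAlg (x : FreeZero V) : mk F (wordAlg F x) = evalWord (of F) x := by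
  induction x using FreeZero.induction with
  | zero => rfl
  | word_one a => rfl
  | word_mul a x ih => rw [evalWord_mul, ← ih, wordAlg_mul]; rfl

theorem mk_eq_of_rel {a b : FreeAlg F V} (h : LeavittRel F a b) : mk F a = mk F b :=
  Quotient.sound (RingConGen.Rel.of _ _ ⟨1, a, b, h, (one_smul ..).symm, (one_smul ..).symm⟩)

/-- Relation (v) is the case of (5) in which the sum has a single term. -/
theorem satisfiesLRel_of : SatisfiesLRel (of F (V := V)) := by
  intro x y h
  rw [← mk_wordAlg, ← mk_wordAlg]
  cases h with
  | graph h => exact mk_eq_of_rel F (.graph h)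
  | outDegree_one v e hv he =>
    obtain ⟨f, hf⟩ := Set.encard_eq_one.1 hv
    have hfin : (outEdges v).Finite := hf ▸ Set.finite_singleton f
    have hs : hfin.toFinset = {e} := by
      ext x
      rw [hf] at he
      cases he
      simp [hf]
    have h := mk_eq_of_rel F (.cuntzKrieger v hfin ⟨e, he⟩)
    rw [hs, Finset.sum_singleton] at h
    exact h.symm

end LeavittPathAlgebra

namespace Branching

variable {F} (B : Branching V)

variable (F) in
/-- The representation of the free algebra by linear operators on functions. -/
noncomputable def freeRep : FreeAlg F V →ₙₐ[F] Module.End F (V × ℕ × ℤ → F) :=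
  MonoidAlgebra.liftMagma F (FreeSemigroup.lift fun g => pullback F (B.gen g))

theorem freeRep_wordAlg (x : FreeZero V) :
    B.freeRep F (wordAlg F x) = pullback F (evalWord B.gen x) := by
  induction x using FreeZero.induction with
  | zero => exact (map_zero _).trans (pullback_zero F).symm
  | word_one a =>
    change B.freeRep F (MonoidAlgebra.single (FreeSemigroup.of a) 1) = pullback F (B.gen a)
    simp [freeRep, MonoidAlgebra.liftMagma]
  | word_mul a x ih =>
    rw [evalWord_mul, pullback_mul, ← ih, wordAlg_mul, map_mul]
    congr 1
    change B.freeRep F (MonoidAlgebra.single (FreeSemigroup.of a) 1) = pullback F (B.gen a)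
    simp [freeRep, MonoidAlgebra.liftMagma]

/-- Each `ee*` acts as restriction to the piece of `e`, and exactly one piece contains a given point
over `v`. -/
theorem pullback_gen_vertex {v : V} (hfin : (outEdges v).Finite) (hne : (outEdges v).Nonempty) :
    pullback F (B.gen (.vertex v)) =
      ∑ e ∈ hfin.toFinset, pullback F (B.gen (.edge e) * B.gen (.ghost e)) := by
  refine LinearMap.ext fun φ => funext fun y => ?_
  rw [LinearMap.sum_apply, Finset.sum_apply]
  by_cases hy : y.1 = v
  · obtain ⟨e, he, z, hz⟩ := B.exists_edge hne hy
    rw [Finset.sum_eq_single e, pullback_of_mem (B.mem_gen_vertex.2 ⟨rfl, hy⟩),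
      pullback_of_mem (B.mem_edge_mul_ghost.2 ⟨rfl, z, hz⟩)]
    · intro f _ hfe
      refine pullback_of_forall_not_mem (fun w hw => ?_) φ
      obtain ⟨-, z', hz'⟩ := B.mem_edge_mul_ghost.1 hw
      exact hfe (B.edge_unique hz' hz)
    · exact fun h => (h (hfin.mem_toFinset.2 he)).elim
  · rw [pullback_of_forall_not_mem fun w hw => hy (B.mem_gen_vertex.1 hw).2]
    refine (Finset.sum_eq_zero fun e he => ?_).symm
    refine pullback_of_forall_not_mem (fun w hw => ?_) φ
    obtain ⟨-, z, hz⟩ := B.mem_edge_mul_ghost.1 hw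
    exact hy ((B.mem_gen hz).1.trans (hfin.mem_toFinset.1 he))

theorem freeRep_eq_of_rel {a b : FreeAlg F V} (h : LeavittRel F a b) :
    B.freeRep F a = B.freeRep F b := by
  cases h with
  | graph h => rw [freeRep_wordAlg, freeRep_wordAlg, B.evalWord_graphRel h]
  | cuntzKrieger v hfin hne =>
    rw [freeRep_wordAlg, map_sum]
    simp only [freeRep_wordAlg, evalWord_mul, evalWord_word]
    exact B.pullback_gen_vertex hfin hne

variable (F) in
/-- The representation of the Leavitt path algebra by linear operators on functions. -/
noncomputable def rep : LeavittPathAlgebra F V → Module.End F (V × ℕ × ℤ → F) :=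
  Quotient.lift (B.freeRep F) fun a b h =>
    (RingCon.ringConGen_le
      (c := { r := fun a b => B.freeRep F a = B.freeRep F b
              iseqv := ⟨fun _ => rfl, Eq.symm, Eq.trans⟩
              mul' := fun h₁ h₂ => by rw [map_mul, map_mul, h₁, h₂]
              add' := fun h₁ h₂ => by rw [map_add, map_add, h₁, h₂] }) |>.2 (by
        rintro _ _ ⟨c, x, y, h, rfl, rfl⟩
        change B.freeRep F (c • x) = B.freeRep F (c • y)
        rw [map_smul, map_smul, B.freeRep_eq_of_rel h])) h

theorem rep_mk (a : FreeAlg F V) : B.rep F (LeavittPathAlgebra.mk F a) = B.freeRep F a := rfl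

end Branching

/-! ### The isomorphism and the inverse property -/

namespace LSemigroup

variable (V)

/-- The homomorphism from `L(Γ)` to the Leavitt path algebra. -/
noncomputable def toLeavittPathAlgebra : LSemigroup V →ₙ* LeavittPathAlgebra F V :=
  lift (LeavittPathAlgebra.of F) (LeavittPathAlgebra.satisfiesLRel_of F)

variable {V}

theorem toLeavittPathAlgebra_mk (x : FreeZero V) :
    toLeavittPathAlgebra F V (mk V x) = LeavittPathAlgebra.mk F (wordAlg F x) :=
  (LeavittPathAlgebra.mk_wordAlg F x).symm

theorem toLeavittPathAlgebra_injective (B : Branching V) :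
    Function.Injective (toLeavittPathAlgebra F V) := by
  -- On the image of `L(Γ)` the representation is the faithful action followed by the injective
  -- `pullback`.
  have key : ∀ x, B.rep F (toLeavittPathAlgebra F V x) = pullback F (B.action x) := by
    intro x
    obtain ⟨x, rfl⟩ := mk_surjective x
    rw [toLeavittPathAlgebra_mk, B.rep_mk, B.freeRep_wordAlg]
    rfl
  intro x y h
  apply B.action_injective
  apply pullback_injective F
  rw [← key, ← key, h]

theorem srange_toLeavittPathAlgebra : (toLeavittPathAlgebra F V).srange = LI F V := by
  apply le_antisymm
  · rintro _ ⟨x, rfl⟩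
    obtain ⟨x, rfl⟩ := mk_surjective x
    induction x using FreeZero.induction with
    | zero => exact Subsemigroup.subset_closure (Set.mem_insert _ _)
    | word_one a => exact Subsemigroup.subset_closure (Set.mem_insert_of_mem _ ⟨a, rfl⟩)
    | word_mul a x ih =>
      rw [mk_mul, map_mul]
      exact mul_mem (Subsemigroup.subset_closure (Set.mem_insert_of_mem _ ⟨a, rfl⟩)) ih
  · refine Subsemigroup.closure_le.2 (Set.insert_subset ⟨0, rfl⟩ ?_)
    rintro _ ⟨a, rfl⟩
    exact ⟨of a, rfl⟩

/-- The isomorphism from `L(Γ)` to the Leavitt inverse semigroup. -/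
noncomputable def equivLI (B : Branching V) : LSemigroup V ≃* LI F V :=
  MulEquiv.ofBijective
    ((toLeavittPathAlgebra F V).codRestrict (LI F V) fun x => by
      rw [← srange_toLeavittPathAlgebra]; exact ⟨x, rfl⟩)
    ⟨fun _ _ h => toLeavittPathAlgebra_injective F B (congrArg Subtype.val h), fun ⟨y, hy⟩ => by
      rw [← srange_toLeavittPathAlgebra] at hy
      obtain ⟨x, rfl⟩ := hy
      exact ⟨x, rfl⟩⟩

/-- The action embeds `L(Γ)` in the partial bijections, with image closed under inversion, since
`qp*` acts as the inverse of `pq*`. Uniqueness is inherited. -/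
theorem isInverseSemigroup (B : Branching V) : IsInverseSemigroup (LSemigroup V) := by
  intro x
  have huniq : ∀ y, x * y * x = x → y * x * y = y → B.action y = (B.action x).symm :=
    fun y h₁ h₂ => pequiv_eq_symm (by rw [← map_mul, ← map_mul, h₁])
      (by rw [← map_mul, ← map_mul, h₂])
  have hex : ∃ y, B.action y = (B.action x).symm := by
    obtain rfl | ⟨t, -, rfl⟩ := eq_zero_or_canonical x
    · exact ⟨0, PEquiv.symm_bot.symm⟩
    · exact ⟨PathPair.val of ⟨t.q, t.p⟩, by rw [B.action_val, B.action_val, B.val_symm]⟩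
  obtain ⟨y, hy⟩ := hex
  refine ⟨y, ⟨?_, ?_⟩, fun z hz => B.action_injective ((huniq z hz.1 hz.2).trans hy.symm)⟩ <;>
    apply B.action_injective <;> rw [map_mul, map_mul, hy]
  · exact pequiv_mul_symm_mul _
  · exact pequiv_mul_symm_mul (B.action x).symm

end LSemigroup

theorem IsInverseSemigroup.of_mulEquiv {S T : Type*} [Semigroup S] [Semigroup T] (φ : S ≃* T)
    (h : IsInverseSemigroup S) : IsInverseSemigroup T := by
  intro a
  obtain ⟨b, ⟨h₁, h₂⟩, hb⟩ := h (φ.symm a)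
  refine ⟨φ b, ⟨?_, ?_⟩, fun c hc => ?_⟩
  · simpa using congrArg φ h₁
  · simpa using congrArg φ h₂
  · rw [← hb (φ.symm c) ⟨by rw [← map_mul, ← map_mul, hc.1], by rw [← map_mul, ← map_mul, hc.2]⟩,
      φ.apply_symm_apply]

end LeavittPathAlgebra

end LeavittGraph

theorem mainTheorem3 {F : Type*} [Field F] {V : Type*} [Quiver V]
    (hΓ : ∀ v : V, (LeavittGraph.outEdges v).Finite) :
    (∃ φ : LeavittGraph.LSemigroup V ≃* LeavittGraph.LI F V,
      (φ 0 : LeavittGraph.LeavittPathAlgebra F V) = 0 ∧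
      ∀ g : LeavittGraph.Gen V, φ (LeavittGraph.LSemigroup.of g) = LeavittGraph.LI.of F g) ∧
    LeavittGraph.IsInverseSemigroup (LeavittGraph.LI F V) ∧
    LeavittGraph.IsInverseSemigroup (LeavittGraph.LSemigroup V) ∧
    (∀ x : LeavittGraph.LI F V, (x : LeavittGraph.LeavittPathAlgebra F V) ≠ 0 →
      ∃! t : LeavittGraph.PathPair V, t.IsCanonical ∧ x = t.val (LeavittGraph.LI.of F)) ∧
    (∀ t : LeavittGraph.PathPair V, t.IsCanonical →
      ((t.val (LeavittGraph.LI.of F) : LeavittGraph.LI F V) :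
        LeavittGraph.LeavittPathAlgebra F V) ≠ 0) ∧
    (∀ x : LeavittGraph.LSemigroup V, x ≠ 0 →
      ∃! t : LeavittGraph.PathPair V, t.IsCanonical ∧ x = t.val LeavittGraph.LSemigroup.of) ∧
    (∀ t : LeavittGraph.PathPair V, t.IsCanonical → t.val LeavittGraph.LSemigroup.of ≠ 0) := by
  obtain ⟨B⟩ := LeavittGraph.Branching.nonempty hΓ
  let φ := LeavittGraph.LSemigroup.equivLI F B
  have hzero : (φ 0 : LeavittGraph.LeavittPathAlgebra F V) = 0 := rfl
  have hval : ∀ t : LeavittGraph.PathPair V,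
      φ (t.val LeavittGraph.LSemigroup.of) = t.val (LeavittGraph.LI.of F) :=
    fun t => t.map_val φ LeavittGraph.LSemigroup.of
  have hinv := LeavittGraph.LSemigroup.isInverseSemigroup B
  -- No canonicity is needed here: every `pq*` acts with nonempty domain, because any point over the
  -- common range can be pulled back along both paths.
  have hne : ∀ t : LeavittGraph.PathPair V, t.val LeavittGraph.LSemigroup.of ≠ 0 := by
    intro t h
    exact B.val_ne_zero t (by rw [← B.action_val, h]; rfl)
  have huniq : ∀ x : LeavittGraph.LSemigroup V, x ≠ 0 →
      ∃! t : LeavittGraph.PathPair V, t.IsCanonical ∧ x = t.val LeavittGraph.LSemigroup.of := by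
    intro x hx
    obtain ⟨t, ht, rfl⟩ := (LeavittGraph.LSemigroup.eq_zero_or_canonical x).resolve_left hx
    exact ⟨t, ⟨ht, rfl⟩, fun t' ht' => B.eq_of_val_eq ht'.1 ht (by
      rw [← B.action_val, ← B.action_val, ht'.2])⟩
  refine ⟨⟨φ, hzero, fun _ => rfl⟩, hinv.of_mulEquiv φ, hinv, fun x hx => ?_, fun t _ h => ?_,
    huniq, fun t _ => hne t⟩
  · obtain ⟨x, rfl⟩ := φ.surjective x
    simp only [← hval, φ.injective.eq_iff]
    exact huniq x (by rintro rfl; exact hx hzero)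
  · rw [← hval, ← hzero] at h
    exact hne t (φ.injective (Subtype.ext h))
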